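/- Let $\Bbbk$ be a field, let $\mathbf z=(z_{ij})_{i,j=1}^n$ be the generic $n\times n$ matrix of variables, and let $\pi\in S_n$. For $1\le p,q\le n$ let $r_{pq}(\pi)=\#\{i\le p:\pi(i)\le q\}$ and let $\mathbf z_{p\times q}$ be the northwest $p\times q$ submatrix of $\mathbf z$. Let $B_\pi\subset\Bbbk[\mathbf z]$ be the set of all minors of size $1+r_{pq}(\pi)$ in $\mathbf z_{p\times q}$, over all $(p,q)\in\{1,\dots,n\}^2$; the Schubert determinantal ideal $I_\pi$ is the ideal generated by $B_\pi$. Let $D(\pi)=\{(p,q)\in\{1,\dots,n\}^2:\pi(p)>q,\ \pi^{-1}(q)>p\}$ and $\mathcal{E}ss(\pi)=\{(p,q)\in D(\pi):(p+1,q),(p,q+1)\notin D(\pi)\}$, and let $A_\pi\subseteq B_\pi$ be the set of essential minors, i.e. the minors of size $1+r_{pq}(\pi)$ in $\mathbf z_{p\times q}$ over all $(p,q)\in\mathcal{E}ss(\pi)$. A term order on $\Bbbk[\mathbf z]$ is called diagonal if the leading monomial of every minor of $\mathbf z$ is the product of the entries on the main diagonal of that minor. The permutation $\pi$ is vexillary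 if there are no $a<b<c<d$ with $\pi(b)<\pi(a)<\pi(d)<\pi(c)$. **Theorem.** If $\pi\in S_n$ is not vexillary, then neither $A_\pi$ nor $B_\pi$ is a Gröbner basis of $I_\pi$ under any diagonal term order. -/

import Mathlib

/-!
Boxes of the `n × n` grid are pairs in `Fin n × Fin n`, counted from `0`: the box `(p, q)` here is
the box in row `p + 1` and column `q + 1`.  Accordingly the northwest corner that has `(p, q)` as
its southeast box consists of the rows `≤ p` and the columns `≤ q`.
-/

namespace SchubertDet

section Permutations

/-- `π` is vexillary (2143-avoiding). -/
def IsVexillary {n : ℕ} (π : Equiv.Perm (Fin n)) : Prop :=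
  ¬ ∃ a b c d : Fin n, a < b ∧ b < c ∧ c < d ∧ π b < π a ∧ π a < π d ∧ π d < π c

/-- The number of dots `(i, π i)` in the northwest corner with southeast box `(p, q)`. -/
def rank {n : ℕ} (π : Equiv.Perm (Fin n)) (p q : Fin n) : ℕ :=
  (Finset.univ.filter fun i : Fin n => i ≤ p ∧ π i ≤ q).card

/-- The diagram of `π`. -/
def diagram {n : ℕ} (π : Equiv.Perm (Fin n)) : Set (Fin n × Fin n) :=
  {b | b.2 < π b.1 ∧ b.1 < π.symm b.2}

/-- The essential set of `π`: the boxes of the diagram whose neighbours to the south and to the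
east are not boxes of the diagram (boxes outside the grid are not in the diagram). -/
def essentialSet {n : ℕ} (π : Equiv.Perm (Fin n)) : Set (Fin n × Fin n) :=
  {b | b ∈ diagram π ∧
    (∀ p' : Fin n, (p' : ℕ) = b.1 + 1 → (p', b.2) ∉ diagram π) ∧
    (∀ q' : Fin n, (q' : ℕ) = b.2 + 1 → (b.1, q') ∉ diagram π)}

end Permutations

section Minors

/-- The minor of the generic `n × n` matrix `(z_ij)` with rows `f 0 < f 1 < ⋯` and columns
`g 0 < g 1 < ⋯`. -/
noncomputable def minor (K : Type*) [Field K] {n k : ℕ} (f g : Fin k ↪o Fin n) :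
    MvPolynomial (Fin n × Fin n) K :=
  ((Matrix.mvPolynomialX (Fin n) (Fin n) K).submatrix f g).det

/-- The minors of size `k` in the northwest corner with southeast box `(p, q)`. -/
def cornerMinors (K : Type*) [Field K] {n : ℕ} (k : ℕ) (p q : Fin n) :
    Set (MvPolynomial (Fin n × Fin n) K) :=
  {P | ∃ f g : Fin k ↪o Fin n, (∀ i, f i ≤ p) ∧ (∀ i, g i ≤ q) ∧ P = minor K f g}

/-- `A_π`: the essential minors. -/
def essentialMinors (K : Type*) [Field K] {n : ℕ} (π : Equiv.Perm (Fin n)) :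
    Set (MvPolynomial (Fin n × Fin n) K) :=
  ⋃ b ∈ essentialSet π, cornerMinors K (1 + rank π b.1 b.2) b.1 b.2

/-- `B_π`: the rank minors for all boxes of the grid. -/
def rankMinors (K : Type*) [Field K] {n : ℕ} (π : Equiv.Perm (Fin n)) :
    Set (MvPolynomial (Fin n × Fin n) K) :=
  ⋃ b : Fin n × Fin n, cornerMinors K (1 + rank π b.1 b.2) b.1 b.2

/-- The Schubert determinantal ideal `I_π`. -/
noncomputable def schubertIdeal (K : Type*) [Field K] {n : ℕ} (π : Equiv.Perm (Fin n)) :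
    Ideal (MvPolynomial (Fin n × Fin n) K) :=
  Ideal.span (rankMinors K π)

end Minors

section GroebnerBases

/-- The initial ideal of `I`: the ideal generated by the leading terms of all elements of `I`. -/
noncomputable def initialIdeal {K σ : Type*} [Field K] (m : MonomialOrder σ) (I : Ideal (MvPolynomial σ K)) :
    Ideal (MvPolynomial σ K) :=
  Ideal.span {t | ∃ P ∈ I, t = m.leadingTerm P}

/-- `G` is a Gröbner basis of `I`: it lies in `I` and its leading terms generate the initial
ideal of `I`. -/
def IsGroebnerBasis {K σ : Type*} [Field K] (m : MonomialOrder σ)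
    (G : Set (MvPolynomial σ K)) (I : Ideal (MvPolynomial σ K)) : Prop :=
  G ⊆ I ∧ Ideal.span {t | ∃ P ∈ G, t = m.leadingTerm P} = initialIdeal m I

/-- A term order is diagonal if the leading monomial of every minor of the generic matrix is the
product of the variables on the main diagonal of that minor. -/
def IsDiagonal (K : Type*) [Field K] {n : ℕ} (m : MonomialOrder (Fin n × Fin n)) : Prop :=
  ∀ (k : ℕ) (f g : Fin k ↪o Fin n),
    m.degree (minor K f g) = ∑ i : Fin k, Finsupp.single (f i, g i) 1

end GroebnerBases

end SchubertDet

/-!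
Since `A_π ⊆ B_π ⊆ I_π`, it suffices to show that the rank minors `B_π` are not a Gröbner basis.

Let `a < b < c < d` be a `2143` pattern in `π`, and let `P` be the `0`-`1` matrix whose ones are the
dots of `π` in the northwest corner of the box `(c, π d)`, together with this box itself.  With
`ρ = π * swap c d` the ones of `P` are the positions `(i, ρ i)` with `i ≤ c` and `ρ i ≤ ρ c`
(`pointMatrix`).  The corner of `(c, π d)` contains exactly `1 + rank π c (π d)` ones of `P`, no two
in the same row or column, so one of the rank minors of this box is nonzero at `P`
(`exists_rankMinor_eval_ne_zero`).  In the corner of a box that is not weakly southeast of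
`(c, π d)`, however, `P` has at most as many ones as `π` has dots, so that all rank minors of such a
box vanish at `P` (`le_of_eval_minor_ne_zero`).

A rank minor that does not vanish at `P` therefore uses exactly the rows and the columns in which
`P` has a one.  Since `(a, π a)` and `(b, π b)` are an inversion of `π`, the box `(a, π b)` has
no dot of `π` in its row or column within its corner, whereas `P` has a one in row `a` and a one in
column `π b`.  So the first `1 + rank π a (π b)` rows and columns of the minor lie in the corner of
`(a, π b)`: they are the rows and columns of a rank minor that vanishes at `P`, and its diagonal
term divides the diagonal term of the given minor (`exists_degree_le`).

Hence, if `B_π` were a Gröbner basis, then so would be the set of those elements of `B_π` that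
vanish at `P`, and all of `I_π` would vanish at `P`
(`le_of_forall_exists_degree_le`), which is not the case.
-/

namespace SchubertDet

open Finset MvPolynomial

/-! ### Gröbner bases -/

section Groebner

variable {K σ : Type*} [Field K] {m : MonomialOrder σ}

/-- If the leading monomial of every nonzero element of `I` is divisible by the leading monomial of
an element of `B ⊆ I`, then `B` generates `I`, by division with remainder; here in the form that
every ideal containing `B` contains `I`. -/
theorem le_of_forall_exists_degree_le {I N : Ideal (MvPolynomial σ K)} {B : Set (MvPolynomial σ K)}
    (hBI : B ⊆ I) (hBN : B ⊆ N) (hB0 : ∀ b ∈ B, b ≠ 0)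
    (h : ∀ f ∈ I, f ≠ 0 → ∃ b ∈ B, m.degree b ≤ m.degree f) : I ≤ N := by
  intro f hf
  obtain ⟨g, r, hfr, -, hr⟩ := m.div_set (B := B)
    (fun b hb => (m.leadingCoeff_ne_zero_iff.mpr (hB0 b hb)).isUnit) f
  have key : ∀ J : Ideal (MvPolynomial σ K), B ⊆ J →
      Finsupp.linearCombination _ (fun b : B => (b : MvPolynomial σ K)) g ∈ J := by
    intro J hJ
    rw [Finsupp.linearCombination_apply]
    exact J.sum_mem fun b _ => J.mul_mem_left _ (hJ b.2)
  have hrI : r ∈ I := by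
    have := I.sub_mem hf (key I hBI)
    rwa [hfr, add_sub_cancel_left] at this
  have hr0 : r = 0 := by
    by_contra hne
    obtain ⟨b, hb, hle⟩ := h r hrI hne
    exact hr _ (m.degree_mem_support hne) b hb hle
  rw [hfr, hr0, add_zero]
  exact key N hBN

theorem IsGroebnerBasis.exists_degree_le {G : Set (MvPolynomial σ K)}
    {I : Ideal (MvPolynomial σ K)} (hG : IsGroebnerBasis m G I) {f : MvPolynomial σ K}
    (hf : f ∈ I) (hf0 : f ≠ 0) : ∃ b ∈ G, b ≠ 0 ∧ m.degree b ≤ m.degree f := by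
  have hmem : m.leadingTerm f ∈ Ideal.span (m.leadingTerm '' G) := by
    have himage : m.leadingTerm '' G = {t | ∃ P ∈ G, t = m.leadingTerm P} := by
      ext t
      simp only [Set.mem_image, Set.mem_ofPred_eq, eq_comm]
    rw [himage, hG.2]
    exact Ideal.subset_span ⟨f, hf, rfl⟩
  rw [m.span_leadingTerm_eq_span_monomial', ← Set.image_image (fun s => monomial s (1 : K)),
    mem_ideal_span_monomial_image] at hmem
  obtain ⟨_, ⟨b, hb, rfl⟩, hle⟩ := hmem (m.degree f) (by
    classical
    simp [MonomialOrder.leadingTerm, mem_support_iff, hf0])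
  exact ⟨b, hb.1, hb.2, hle⟩

theorem IsGroebnerBasis.mono {G G' : Set (MvPolynomial σ K)} {I : Ideal (MvPolynomial σ K)}
    (hG : IsGroebnerBasis m G I) (hGG' : G ⊆ G') (hG' : G' ⊆ I) : IsGroebnerBasis m G' I := by
  refine ⟨hG', le_antisymm ?_ ?_⟩
  · refine Ideal.span_mono ?_
    rintro t ⟨P, hP, rfl⟩
    exact ⟨P, hG' hP, rfl⟩
  · rw [← hG.2]
    refine Ideal.span_mono ?_
    rintro t ⟨P, hP, rfl⟩
    exact ⟨P, hGG' hP, rfl⟩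

end Groebner

/-! ### Increasing sequences -/

/-- If the values of an increasing sequence `f` include a set with more than `t` elements `≤ a`,
then the entry of `f` at position `t` is `≤ a`. -/
theorem le_of_lt_card_filter {k n : ℕ} (f : Fin k ↪o Fin n) {S : Finset (Fin n)}
    (hS : ∀ x ∈ S, ∃ i, f i = x) {a : Fin n} {t : Fin k}
    (ht : (t : ℕ) < (S.filter (· ≤ a)).card) : f t ≤ a := by
  by_contra! hlt
  have hsub : S.filter (· ≤ a) ⊆ (Finset.Iio t).image f := by
    intro x hx
    obtain ⟨hxS, hxa⟩ := Finset.mem_filter.mp hx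
    obtain ⟨i, rfl⟩ := hS x hxS
    exact Finset.mem_image_of_mem _ (Finset.mem_Iio.mpr (f.lt_iff_lt.mp (hxa.trans_lt hlt)))
  have := (Finset.card_le_card hsub).trans Finset.card_image_le
  rw [Fin.card_Iio] at this
  omega

theorem exists_eq_of_mem_of_card_le {k n : ℕ} (f : Fin k ↪o Fin n) {S : Finset (Fin n)}
    (hf : ∀ i, f i ∈ S) (hS : S.card ≤ k) : ∀ x ∈ S, ∃ i, f i = x := by
  have hsub : Finset.univ.image f ⊆ S := by
    intro x hx
    obtain ⟨i, -, rfl⟩ := Finset.mem_image.mp hx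
    exact hf i
  have heq := Finset.eq_of_subset_of_card_le hsub (by
    rwa [Finset.card_image_of_injective _ f.injective, Finset.card_univ, Fintype.card_fin])
  intro x hx
  rw [← heq] at hx
  obtain ⟨i, -, hi⟩ := Finset.mem_image.mp hx
  exact ⟨i, hi⟩

/-! ### A partial permutation matrix -/

section PointMatrix

variable {n : ℕ}

/-- The rows of the dots of `ρ` that are weakly northwest of the dot in row `c`. -/
def pointRows (ρ : Equiv.Perm (Fin n)) (c : Fin n) : Finset (Fin n) :=
  Finset.univ.filter fun i => i ≤ c ∧ ρ i ≤ ρ c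

theorem mem_pointRows {ρ : Equiv.Perm (Fin n)} {c i : Fin n} :
    i ∈ pointRows ρ c ↔ i ≤ c ∧ ρ i ≤ ρ c := by
  simp [pointRows]

/-- The partial permutation matrix whose ones are the dots of `ρ` that are weakly northwest of the
dot in row `c`. -/
def pointMatrix (K : Type*) [Field K] (ρ : Equiv.Perm (Fin n)) (c : Fin n) :
    Matrix (Fin n) (Fin n) K :=
  Matrix.of fun i j => if i ∈ pointRows ρ c ∧ ρ i = j then 1 else 0

variable {K : Type*} [Field K]

theorem eval_minor (M : Matrix (Fin n) (Fin n) K) {k : ℕ} (f g : Fin k ↪o Fin n) :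
    eval (fun b => M b.1 b.2) (minor K f g) = (M.submatrix f g).det := by
  rw [minor, RingHom.map_det]
  congr 1
  ext i j
  simp [Matrix.mvPolynomialX]

theorem row_of_det_ne_zero {ρ : Equiv.Perm (Fin n)} {c : Fin n} {k : ℕ} {f g : Fin k ↪o Fin n}
    (h : ((pointMatrix K ρ c).submatrix f g).det ≠ 0) (i : Fin k) :
    f i ∈ pointRows ρ c ∧ ∃ j, g j = ρ (f i) := by
  by_contra hi
  refine h (Matrix.det_eq_zero_of_row_eq_zero i fun j => ?_)
  rw [Matrix.submatrix_apply, pointMatrix, Matrix.of_apply, if_neg]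
  exact fun hj => hi ⟨hj.1, j, hj.2.symm⟩

theorem column_of_det_ne_zero {ρ : Equiv.Perm (Fin n)} {c : Fin n} {k : ℕ} {f g : Fin k ↪o Fin n}
    (h : ((pointMatrix K ρ c).submatrix f g).det ≠ 0) (j : Fin k) :
    g j ∈ (pointRows ρ c).image ρ := by
  by_contra hj
  refine h (Matrix.det_eq_zero_of_column_eq_zero j fun i => ?_)
  rw [Matrix.submatrix_apply, pointMatrix, Matrix.of_apply, if_neg]
  exact fun hi => hj (Finset.mem_image.mpr ⟨_, hi.1, hi.2⟩)

/-- A minor in the corner of `(p, q)` that is nonzero at `pointMatrix K ρ c` has at most as many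
rows as this matrix has ones in the corner. -/
theorem size_le_of_det_ne_zero {ρ : Equiv.Perm (Fin n)} {c p q : Fin n} {k : ℕ}
    {f g : Fin k ↪o Fin n} (hf : ∀ i, f i ≤ p) (hg : ∀ j, g j ≤ q)
    (h : ((pointMatrix K ρ c).submatrix f g).det ≠ 0) :
    k ≤ ((pointRows ρ c).filter fun i => i ≤ p ∧ ρ i ≤ q).card := by
  have hsub : Finset.univ.image f ⊆ (pointRows ρ c).filter fun i => i ≤ p ∧ ρ i ≤ q := by
    intro x hx
    obtain ⟨i, -, rfl⟩ := Finset.mem_image.mp hx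
    obtain ⟨hi, j, hj⟩ := row_of_det_ne_zero h i
    exact Finset.mem_filter.mpr ⟨hi, hf i, hj ▸ hg j⟩
  simpa [Finset.card_image_of_injective _ f.injective] using Finset.card_le_card hsub

/-- The minor of `pointMatrix K ρ c` on its nonzero rows and columns is the determinant of a
permutation matrix. -/
theorem exists_det_ne_zero (ρ : Equiv.Perm (Fin n)) (c : Fin n) {k : ℕ}
    (hk : (pointRows ρ c).card = k) :
    ∃ f g : Fin k ↪o Fin n, (∀ i, f i ≤ c) ∧ (∀ j, g j ≤ ρ c) ∧
      ((pointMatrix K ρ c).submatrix f g).det ≠ 0 := by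
  have hk' : ((pointRows ρ c).image ρ).card = k := by
    rw [Finset.card_image_of_injective _ ρ.injective, hk]
  have hf : ∀ i, (pointRows ρ c).orderEmbOfFin hk i ∈ pointRows ρ c :=
    Finset.orderEmbOfFin_mem _ hk
  have hg := Finset.orderEmbOfFin_mem _ hk'
  have hex := exists_eq_of_mem_of_card_le _ hg hk'.le
  generalize (pointRows ρ c).orderEmbOfFin hk = f at hf
  generalize ((pointRows ρ c).image ρ).orderEmbOfFin hk' = g at hg hex
  refine ⟨f, g, fun i => (mem_pointRows.mp (hf i)).1, fun j => ?_, ?_⟩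
  · obtain ⟨i, hi, hij⟩ := Finset.mem_image.mp (hg j)
    exact hij ▸ (mem_pointRows.mp hi).2
  · choose e he using fun i => hex (ρ (f i)) (Finset.mem_image_of_mem _ (hf i))
    have hinj : Function.Injective e := by
      intro i j hij
      have : ρ (f i) = ρ (f j) := by rw [← he, ← he, hij]
      exact f.injective (ρ.injective this)
    let σ : Equiv.Perm (Fin k) := Equiv.ofBijective e (Finite.injective_iff_bijective.mp hinj)
    have hone : ((pointMatrix K ρ c).submatrix f g).submatrix id σ = 1 := by
      ext i j
      simp only [Matrix.submatrix_apply, id_eq, pointMatrix, Matrix.of_apply, hf i, true_and,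
        Matrix.one_apply, σ, Equiv.ofBijective_apply, he, EmbeddingLike.apply_eq_iff_eq]
    intro hdet
    have := Matrix.det_permute' σ ((pointMatrix K ρ c).submatrix f g)
    rw [hone, hdet] at this
    simp at this

end PointMatrix

/-! ### Rank minors at a 2143 pattern -/

section Pattern

variable {K : Type*} [Field K] {n : ℕ} {π : Equiv.Perm (Fin n)} {a b c d : Fin n}

theorem mul_swap_apply_of_lt {i : Fin n} (hcd : c < d) (hi : i < c) :
    (π * Equiv.swap c d) i = π i := by
  rw [Equiv.Perm.mul_apply, Equiv.swap_apply_of_ne_of_ne hi.ne (hi.trans hcd).ne]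

theorem pointRows_mul_swap (hcd : c < d) (hdc : π d < π c) :
    pointRows (π * Equiv.swap c d) c =
      insert c (Finset.univ.filter fun i => i ≤ c ∧ π i ≤ π d) := by
  ext i
  rw [mem_pointRows, Finset.mem_insert, Finset.mem_filter]
  have hc : (π * Equiv.swap c d) c = π d := by simp
  rw [hc]
  rcases lt_trichotomy i c with h | rfl | h
  · simp [mul_swap_apply_of_lt hcd h, h.ne]
  · simp [hc]
  · simp [h.not_ge, h.ne']

theorem card_pointRows_mul_swap (hcd : c < d) (hdc : π d < π c) :
    (pointRows (π * Equiv.swap c d) c).card = 1 + rank π c (π d) := by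
  rw [pointRows_mul_swap hcd hdc, Finset.card_insert_of_notMem (by simp [hdc]), rank, add_comm]

/-- The ones of the matrix other than the one at `(c, π d)` are dots of `π`, so a rank minor of
`(p, q)` can only be nonzero at the matrix if `(c, π d)` lies in the corner of `(p, q)`. -/
theorem le_of_eval_minor_ne_zero (hcd : c < d) {p q : Fin n}
    {f g : Fin (1 + rank π p q) ↪o Fin n} (hf : ∀ i, f i ≤ p) (hg : ∀ j, g j ≤ q)
    (h : ((pointMatrix K (π * Equiv.swap c d) c).submatrix f g).det ≠ 0) : c ≤ p ∧ π d ≤ q := by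
  by_contra hpq
  have hle := size_le_of_det_ne_zero hf hg h
  have hsub : ((pointRows (π * Equiv.swap c d) c).filter fun i =>
      i ≤ p ∧ (π * Equiv.swap c d) i ≤ q) ⊆ Finset.univ.filter fun i => i ≤ p ∧ π i ≤ q := by
    intro i hi
    obtain ⟨hiR, hip, hiq⟩ := Finset.mem_filter.mp hi
    rcases (mem_pointRows.mp hiR).1.lt_or_eq with hic | rfl
    · rw [mul_swap_apply_of_lt hcd hic] at hiq
      exact Finset.mem_filter.mpr ⟨Finset.mem_univ _, hip, hiq⟩
    · exact absurd ⟨hip, by simpa using hiq⟩ hpq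
  have := Finset.card_le_card hsub
  rw [rank] at hle
  omega

theorem rank_mono {p p' q q' : Fin n} (hp : p ≤ p') (hq : q ≤ q') : rank π p q ≤ rank π p' q' := by
  refine Finset.card_le_card fun i hi => ?_
  simp only [Finset.mem_filter, Finset.mem_univ, true_and] at hi ⊢
  exact ⟨hi.1.trans hp, hi.2.trans hq⟩

theorem exists_rankMinor_eval_ne_zero (hcd : c < d) (hdc : π d < π c) :
    ∃ P ∈ rankMinors K π,
      eval (fun x => pointMatrix K (π * Equiv.swap c d) c x.1 x.2) P ≠ 0 := by
  obtain ⟨f, g, hf, hg, hdet⟩ :=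
    exists_det_ne_zero (K := K) (π * Equiv.swap c d) c (card_pointRows_mul_swap hcd hdc)
  refine ⟨minor K f g, Set.mem_iUnion.mpr ⟨(c, π d), f, g, hf, ?_, rfl⟩, ?_⟩
  · simpa using hg
  · rwa [eval_minor]

/-- The rows of the matrix down to `a` that have a one are at least those of the dots of `π` in the
corner of `(a, π b)` and the row `a`. -/
theorem rank_lt_card_rows (hab : a < b) (hbc : b < c) (hcd : c < d) (hba : π b < π a)
    (had : π a < π d) (hdc : π d < π c) :
    rank π a (π b) < ((pointRows (π * Equiv.swap c d) c).filter (· ≤ a)).card := by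
  rw [rank]
  refine Finset.card_lt_card (Finset.ssubset_iff.mpr ⟨a, by simp [hba], ?_⟩)
  intro i hi
  rw [pointRows_mul_swap hcd hdc]
  rcases Finset.mem_insert.mp hi with rfl | hi
  · simp [(hab.trans hbc).le, had.le]
  · simp only [Finset.mem_filter, Finset.mem_univ, true_and] at hi
    simp [hi.1, hi.1.trans (hab.trans hbc).le, hi.2.trans (hba.trans had).le]

/-- The columns of the matrix up to `π b` that have a one are at least those of the dots of `π` in
the corner of `(a, π b)` and the column `π b`. -/
theorem rank_lt_card_columns (hab : a < b) (hbc : b < c) (hcd : c < d) (hba : π b < π a)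
    (had : π a < π d) :
    rank π a (π b) <
      (((pointRows (π * Equiv.swap c d) c).image (π * Equiv.swap c d)).filter (· ≤ π b)).card := by
  have key : ∀ i, i < c → π i ≤ π b → π i ∈
      ((pointRows (π * Equiv.swap c d) c).image (π * Equiv.swap c d)).filter (· ≤ π b) := by
    intro i hi hib
    have happ := mul_swap_apply_of_lt (π := π) hcd hi
    refine Finset.mem_filter.mpr
      ⟨Finset.mem_image.mpr ⟨i, mem_pointRows.mpr ⟨hi.le, ?_⟩, happ⟩, hib⟩
    rw [happ]
    simpa using hib.trans (hba.trans had).le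
  rw [rank, ← Finset.card_image_of_injective _ π.injective]
  refine Finset.card_lt_card (Finset.ssubset_iff.mpr ⟨π b, by simp [hab], ?_⟩)
  intro j hj
  rcases Finset.mem_insert.mp hj with rfl | hj
  · exact key b hbc le_rfl
  · obtain ⟨i, hi, rfl⟩ := Finset.mem_image.mp hj
    simp only [Finset.mem_filter, Finset.mem_univ, true_and] at hi
    exact key i (hi.1.trans_lt (hab.trans hbc)) hi.2

/-- The leading monomial of a rank minor that is nonzero at the matrix is divisible by the leading
monomial of a rank minor that vanishes there, namely of one of the box `(a, π b)`. -/
theorem exists_degree_le {m : MonomialOrder (Fin n × Fin n)} (hm : IsDiagonal K m) (hab : a < b)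
    (hbc : b < c) (hcd : c < d) (hba : π b < π a) (had : π a < π d) (hdc : π d < π c)
    {P : MvPolynomial (Fin n × Fin n) K} (hP : P ∈ rankMinors K π)
    (hP0 : eval (fun x => pointMatrix K (π * Equiv.swap c d) c x.1 x.2) P ≠ 0) :
    ∃ Q ∈ rankMinors K π, Q ≠ 0 ∧
      eval (fun x => pointMatrix K (π * Equiv.swap c d) c x.1 x.2) Q = 0 ∧
      m.degree Q ≤ m.degree P := by
  obtain ⟨⟨p, q⟩, f, g, hf, hg, rfl⟩ := Set.mem_iUnion.mp hP
  dsimp only at f g hf hg hP0 ⊢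
  rw [eval_minor] at hP0
  obtain ⟨hcp, hdq⟩ := le_of_eval_minor_ne_zero hcd hf hg hP0
  have hcard : (pointRows (π * Equiv.swap c d) c).card ≤ 1 + rank π p q := by
    rw [card_pointRows_mul_swap hcd hdc]
    exact Nat.add_le_add_left (rank_mono hcp hdq) 1
  have hrows := exists_eq_of_mem_of_card_le f (fun i => (row_of_det_ne_zero hP0 i).1) hcard
  have hcols := exists_eq_of_mem_of_card_le g (column_of_det_ne_zero hP0)
    (Finset.card_image_le.trans hcard)
  have hle : 1 + rank π a (π b) ≤ 1 + rank π p q :=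
    Nat.add_le_add_left
      (rank_mono ((hab.trans hbc).le.trans hcp) ((hba.trans had).le.trans hdq)) 1
  have hf' : ∀ i, ((Fin.castLEOrderEmb hle).trans f) i ≤ a := fun i =>
    le_of_lt_card_filter f hrows <| lt_of_le_of_lt (Nat.lt_one_add_iff.mp i.2)
      (rank_lt_card_rows hab hbc hcd hba had hdc)
  have hg' : ∀ j, ((Fin.castLEOrderEmb hle).trans g) j ≤ π b := fun j =>
    le_of_lt_card_filter g hcols <| lt_of_le_of_lt (Nat.lt_one_add_iff.mp j.2)
      (rank_lt_card_columns hab hbc hcd hba had)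
  refine ⟨minor K ((Fin.castLEOrderEmb hle).trans f) ((Fin.castLEOrderEmb hle).trans g),
    Set.mem_iUnion.mpr ⟨(a, π b), _, _, hf', hg', rfl⟩, ?_, ?_, ?_⟩
  · -- The zero polynomial has degree `0`, but the diagonal of the minor is not empty.
    intro h0
    have hdeg := hm _ ((Fin.castLEOrderEmb hle).trans f) ((Fin.castLEOrderEmb hle).trans g)
    rw [h0, m.degree_zero] at hdeg
    have := congrArg Finsupp.degree hdeg
    simp only [map_zero, map_sum, Finsupp.degree_single, Finset.sum_const, Finset.card_univ,
      Fintype.card_fin, smul_eq_mul, mul_one] at this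
    omega
  · rw [eval_minor]
    by_contra h0
    exact (hab.trans hbc).not_ge (le_of_eval_minor_ne_zero hcd hf' hg' h0).1
  · rw [hm, hm]
    have := Finset.sum_le_sum_of_subset
      (f := fun i => (Finsupp.single (f i, g i) 1 : Fin n × Fin n →₀ ℕ))
      (Finset.subset_univ (Finset.univ.map (Fin.castLEEmb hle)))
    rwa [Finset.sum_map] at this

theorem not_isGroebnerBasis_rankMinors {m : MonomialOrder (Fin n × Fin n)} (hm : IsDiagonal K m)
    (hab : a < b) (hbc : b < c) (hcd : c < d) (hba : π b < π a) (had : π a < π d)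
    (hdc : π d < π c) : ¬ IsGroebnerBasis m (rankMinors K π) (schubertIdeal K π) := by
  intro hG
  let ε := eval (fun x : Fin n × Fin n => pointMatrix K (π * Equiv.swap c d) c x.1 x.2)
  have hI : schubertIdeal K π ≤ RingHom.ker ε := by
    refine le_of_forall_exists_degree_le (m := m) (B := {P ∈ rankMinors K π | P ≠ 0 ∧ ε P = 0})
      (fun P hP => hG.1 hP.1) (fun P hP => hP.2.2) (fun P hP => hP.2.1) fun F hF hF0 => ?_
    obtain ⟨P, hP, hP0, hPF⟩ := hG.exists_degree_le hF hF0
    by_cases hεP : ε P = 0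
    · exact ⟨P, ⟨hP, hP0, hεP⟩, hPF⟩
    · obtain ⟨Q, hQ, hQ0, hεQ, hQP⟩ := exists_degree_le hm hab hbc hcd hba had hdc hP hεP
      exact ⟨Q, ⟨hQ, hQ0, hεQ⟩, hQP.trans hPF⟩
  obtain ⟨P, hP, hεP⟩ := exists_rankMinor_eval_ne_zero (K := K) hcd hdc
  exact hεP (hI (hG.1 hP))

end Pattern

theorem essentialMinors_subset_rankMinors (K : Type*) [Field K] {n : ℕ}
    (π : Equiv.Perm (Fin n)) : essentialMinors K π ⊆ rankMinors K π :=
  Set.iUnion_mono fun _ => Set.iUnion_subset fun _ => subset_rfl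

end SchubertDet

theorem mainTheorem2 {K : Type*} [Field K] {n : ℕ} (π : Equiv.Perm (Fin n))
    (hπ : ¬ SchubertDet.IsVexillary π) (m : MonomialOrder (Fin n × Fin n))
    (hm : SchubertDet.IsDiagonal K m) :
    ¬ SchubertDet.IsGroebnerBasis m (SchubertDet.essentialMinors K π)
        (SchubertDet.schubertIdeal K π) ∧
      ¬ SchubertDet.IsGroebnerBasis m (SchubertDet.rankMinors K π)
        (SchubertDet.schubertIdeal K π) := by
  obtain ⟨a, b, c, d, hab, hbc, hcd, hba, had, hdc⟩ := not_not.mp hπ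
  have hB := SchubertDet.not_isGroebnerBasis_rankMinors (K := K) hm hab hbc hcd hba had hdc
  exact ⟨fun hA => hB (hA.mono (SchubertDet.essentialMinors_subset_rankMinors K π)
    Ideal.subset_span), hB⟩
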